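/- For positive integers $l,p,q$ at most one of which equals $1$, let $\theta(l,p,q)$ be the graph obtained from three vertex-disjoint paths with $l$, $p$ and $q$ edges by identifying their first endpoints to one vertex and their last endpoints to one vertex. Let $\theta'(l,p,q)$ denote any graph obtained from $\theta(l,p,q)$ by adding one new vertex and joining it by an edge (a pendant edge) to one, arbitrary, vertex of $\theta(l,p,q)$. For a finite connected graph $G$, let $D(G)$ be its distance matrix, whose $(u,v)$ entry is the length of a shortest path between $u$ and $v$. Graphs are considered up to isomorphism. Theorem. Let $G=\theta'(l,p,q)$, where $l,p,q$ are positive integers at most one of which equals $1$. Then: (a) if $G=\theta'(1,p',q')$ for some even positive integers $p'$ and $q'$, then $\det D(G)=\dfrac{(1+p'+q')^2-1}{2}$; (b) if $G=\theta'(2,2,2)$, then $\det D(G)=48$; (c) if $G=\theta'(2,2,q')$ for some odd integer $q'>1$, then $\det D(G)=-2(q'^2+2q'-9)$; (d) otherwise, $\det D(G)=0$. -/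

import Mathlib

/-- The distance matrix `D(G)` of a finite graph: its `(u, v)` entry is the length of a shortest
path between `u` and `v`. -/
noncomputable def SimpleGraph.distanceMatrix {V : Type*} (G : SimpleGraph V) : Matrix V V ℚ :=
  Matrix.of fun u v => (G.dist u v : ℚ)

/-- Vertices of the theta graph built from three paths with `len 0`, `len 1`, `len 2` edges:
the two identified endpoints, and the `len i - 1` interior vertices of each path. -/
abbrev ThetaVertex (len : Fin 3 → ℕ) : Type :=
  Fin 2 ⊕ (Σ i : Fin 3, Fin (len i - 1))

/-- The `k`-th vertex (`0 ≤ k ≤ len i`) of the `i`-th path. All three paths start at the common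
vertex `Sum.inl 0` and end at the common vertex `Sum.inl 1`. -/
def thetaPathVertex (len : Fin 3 → ℕ) (i : Fin 3) (k : ℕ) : ThetaVertex len :=
  if h0 : k = 0 then Sum.inl 0
  else if h : k < len i then Sum.inr ⟨i, ⟨k - 1, by omega⟩⟩
  else Sum.inl 1

/-- The graph `θ(l, p, q)`: three paths with `l`, `p` and `q` edges, with their first endpoints
identified and their last endpoints identified. -/
def thetaGraph (l p q : ℕ) : SimpleGraph (ThetaVertex ![l, p, q]) :=
  SimpleGraph.fromRel fun u v =>
    ∃ i : Fin 3, ∃ k : ℕ, k < ![l, p, q] i ∧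
      u = thetaPathVertex ![l, p, q] i k ∧ v = thetaPathVertex ![l, p, q] i (k + 1)

/-- The graph obtained from `G` by attaching a pendant edge at the vertex `v`;
the new vertex is `none`. -/
def SimpleGraph.withPendant {V : Type*} (G : SimpleGraph V) (v : V) : SimpleGraph (Option V) :=
  G.map Function.Embedding.some ⊔ SimpleGraph.edge (some v) none

/-- `G` is a graph `θ'(l, p, q)`: the integers `l, p, q` are positive, at most one of them is `1`,
and `G` is (up to isomorphism) obtained from `θ(l, p, q)` by attaching a pendant edge at some
vertex. -/
def IsThetaPrime {V : Type*} (G : SimpleGraph V) (l p q : ℕ) : Prop :=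
  (1 ≤ l ∧ 1 ≤ p ∧ 1 ≤ q) ∧
  (¬(l = 1 ∧ p = 1) ∧ ¬(l = 1 ∧ q = 1) ∧ ¬(p = 1 ∧ q = 1)) ∧
  ∃ v, Nonempty (G ≃g (thetaGraph l p q).withPendant v)

/-! Subtracting the row and column of the attaching vertex from those of the pendant vertex turns
`D(G)` into the distance matrix of the theta graph bordered by ones with corner `-2`. The attaching
vertex has disappeared, so only `l`, `p`, `q` matter (`SimpleGraph.det_distanceMatrix_withPendant`).

Vanishing: two paths of equal parity form an even cycle, in which the distances to the two vertices
of an antipodal pair have constant sum. If two antipodal pairs can be chosen that the third path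
does not distinguish, their difference is a kernel vector (`IsThetaPrime.det_eq_zero_of_parallel`).
This leaves only the three exceptional families.

Nonzero values: the bordered matrix is a bilinear form on a lattice, and its determinant may be
computed in any integral basis (`det_gram_eq_of_span`). An odd cycle has only nearly antipodal
pairs; their differences give a chain with Gram matrix `-(I + J)` (`J` the all-ones matrix), whose
inverse is explicit. The basis is completed by two or three vectors of which only one meets the
chain, so a Schur complement leaves a tiny determinant (`det_eq_of_chain`). `θ(2, 2, odd)` is an odd
cycle with one vertex doubled; `θ(1, even, even)` is two odd cycles sharing an edge, whose chains
combine into one. `θ(2, 2, 2)` is a direct computation. -/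

namespace SimpleGraph

/-! ### Distances under maps and isomorphisms -/

variable {V W : Type*}

/-- Source of all lower bounds on distances below: a candidate distance function only has to grow by
at most one along each edge. -/
theorem Reachable.le_add_dist {G : SimpleGraph V} {u w : V} (h : G.Reachable u w) (F : V → ℕ)
    (hF : ∀ x y, G.Adj x y → F y ≤ F x + 1) : F w ≤ F u + G.dist u w := by
  obtain ⟨c, hc⟩ := h.exists_walk_length_eq_dist
  rw [← hc]
  clear hc h
  induction c with
  | nil => simp
  | cons hadj c ih =>
    have := hF _ _ hadj
    simp only [Walk.length_cons]
    omega

theorem dist_map_le {G : SimpleGraph V} {H : SimpleGraph W} (f : G →g H) {u v : V}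
    (h : G.Reachable u v) : H.dist (f u) (f v) ≤ G.dist u v := by
  obtain ⟨c, hc⟩ := h.exists_walk_length_eq_dist
  rw [← hc, ← Walk.length_map f c]
  exact dist_le _

theorem dist_iso {G : SimpleGraph V} {H : SimpleGraph W} (f : G ≃g H) (hG : G.Connected)
    (u v : V) : H.dist (f u) (f v) = G.dist u v := by
  have hH : H.Connected := f.connected_iff.1 hG
  refine le_antisymm (dist_map_le f.toHom (hG u v)) ?_
  simpa using dist_map_le f.symm.toHom (hH (f u) (f v))

theorem det_distanceMatrix_iso [Fintype V] [DecidableEq V] [Fintype W] [DecidableEq W]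
    {G : SimpleGraph V} {H : SimpleGraph W} (f : G ≃g H) (hG : G.Connected) :
    G.distanceMatrix.det = H.distanceMatrix.det := by
  rw [← Matrix.det_submatrix_equiv_self f.toEquiv H.distanceMatrix]
  congr 1
  ext u v
  simp only [distanceMatrix, Matrix.of_apply, Matrix.submatrix_apply]
  exact_mod_cast (dist_iso f hG u v).symm

/-! ### Distances after attaching a pendant edge -/

section Pendant

variable {H : SimpleGraph V} {v : V}

@[simp] theorem withPendant_adj_some {x y : V} :
    (H.withPendant v).Adj (some x) (some y) ↔ H.Adj x y := by
  rw [withPendant, sup_adj, map_adj]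
  simp [edge_adj]

@[simp] theorem withPendant_adj_none {x : V} :
    (H.withPendant v).Adj (some x) none ↔ x = v := by
  rw [withPendant, sup_adj, map_adj]
  simp [edge_adj, eq_comm]

def withPendantHom (H : SimpleGraph V) (v : V) : H →g H.withPendant v :=
  ⟨some, fun h => withPendant_adj_some.2 h⟩

theorem withPendant_reachable (hH : H.Connected) (x : V) (y : Option V) :
    (H.withPendant v).Reachable (some x) y := by
  have key : ∀ y : V, (H.withPendant v).Reachable (some x) (some y) := fun y =>
    (hH x y).map (withPendantHom H v)
  cases y with
  | some y => exact key y
  | none => exact (key v).trans (withPendant_adj_none.2 rfl).reachable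

theorem withPendant_connected (hH : H.Connected) : (H.withPendant v).Connected := by
  have : Nonempty V := hH.nonempty
  obtain ⟨x⟩ := this
  exact Connected.mk (fun a b => (withPendant_reachable hH x a).symm.trans
    (withPendant_reachable hH x b))

theorem withPendant_lipschitz (hH : H.Connected) (a : V) (x y : Option V)
    (h : (H.withPendant v).Adj x y) :
    y.elim (H.dist a v + 1) (H.dist a) ≤ x.elim (H.dist a v + 1) (H.dist a) + 1 := by
  cases x with
  | none =>
    cases y with
    | none => exact absurd h (SimpleGraph.irrefl _)
    | some y =>
      obtain rfl := withPendant_adj_none.1 h.symm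
      simp; omega
  | some x =>
    cases y with
    | none =>
      obtain rfl := withPendant_adj_none.1 h
      simp
    | some y =>
      have h1 := withPendant_adj_some.1 h
      have := hH.dist_triangle (u := a) (v := x) (w := y)
      rw [dist_eq_one_iff_adj.2 h1] at this
      simpa using this

theorem withPendant_dist_some (hH : H.Connected) (a b : V) :
    (H.withPendant v).dist (some a) (some b) = H.dist a b := by
  refine le_antisymm (dist_map_le (withPendantHom H v) (hH a b)) ?_
  simpa using (withPendant_reachable hH a (some b)).le_add_dist _ (withPendant_lipschitz hH a)

theorem withPendant_dist_none (hH : H.Connected) (a : V) :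
    (H.withPendant v).dist (some a) none = H.dist a v + 1 := by
  refine le_antisymm ?_ ?_
  · have := (withPendant_connected (v := v) hH).dist_triangle (u := some a) (v := some v)
      (w := none)
    rwa [withPendant_dist_some hH, dist_eq_one_iff_adj.2 (withPendant_adj_none.2 rfl)] at this
  · simpa using (withPendant_reachable hH a none).le_add_dist _ (withPendant_lipschitz hH a)

end Pendant

end SimpleGraph

/-! ### Path coordinates and the distance formula for theta graphs -/

section ThetaPath

variable {len : Fin 3 → ℕ}

theorem thetaPathVertex_zero (i : Fin 3) : thetaPathVertex len i 0 = Sum.inl 0 := by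
  simp [thetaPathVertex]

theorem thetaPathVertex_len {i : Fin 3} (h : 0 < len i) :
    thetaPathVertex len i (len i) = Sum.inl 1 := by
  simp [thetaPathVertex, h.ne']

theorem thetaPathVertex_inner {i : Fin 3} (k : Fin (len i - 1)) :
    thetaPathVertex len i (k + 1) = Sum.inr ⟨i, k⟩ := by
  have := k.2
  have h : (k : ℕ) + 1 < len i := by omega
  simp [thetaPathVertex, h]

theorem exists_eq_thetaPathVertex (hlen : ∀ i, 0 < len i) (u : ThetaVertex len) :
    ∃ i k, k ≤ len i ∧ u = thetaPathVertex len i k := by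
  rcases u with u | ⟨i, k⟩
  · fin_cases u
    · exact ⟨0, 0, Nat.zero_le _, (thetaPathVertex_zero 0).symm⟩
    · exact ⟨0, len 0, le_rfl, (thetaPathVertex_len (hlen 0)).symm⟩
  · have := k.2
    exact ⟨i, k + 1, by omega, (thetaPathVertex_inner k).symm⟩

/-- The distance in a theta graph with shortest path length `m` between the `k`-th vertex of
path `i` and the `k'`-th vertex of path `j`. -/
def thetaDist (len : Fin 3 → ℕ) (m : ℕ) (i : Fin 3) (k : ℕ) (j : Fin 3) (k' : ℕ) : ℕ :=
  if i = j then min (k - k' + (k' - k)) (len i - (k - k' + (k' - k)) + m)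
  else min (min (k + k') (len i - k + (len j - k')))
    (min (k + m + (len j - k')) (len i - k + m + k'))

/-- `thetaDist` as a function of the second vertex. -/
def thetaDistFun (len : Fin 3 → ℕ) (m : ℕ) (i : Fin 3) (k : ℕ) : ThetaVertex len → ℕ
  | Sum.inl s => if s = 0 then min k (len i - k + m) else min (len i - k) (k + m)
  | Sum.inr s => thetaDist len m i k s.1 (s.2 + 1)

/-- The branch vertices have coordinates on all three paths; minimality of `m` makes the formula
independent of the choice. -/
theorem thetaDistFun_apply {m : ℕ} (hm : ∀ i, m ≤ len i) {i : Fin 3}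
    {k : ℕ} (hk : k ≤ len i) {j : Fin 3} {k' : ℕ} (hk' : k' ≤ len j) :
    thetaDistFun len m i k (thetaPathVertex len j k') = thetaDist len m i k j k' := by
  have h1 := hm i
  have h2 := hm j
  rcases Nat.eq_zero_or_pos k' with rfl | h0
  · rw [thetaPathVertex_zero]
    by_cases hij : i = j
    · subst hij; simp [thetaDistFun, thetaDist]
    · simp [thetaDistFun, thetaDist, hij]; omega
  · rcases hk'.eq_or_lt with rfl | h3
    · rw [thetaPathVertex_len h0]
      by_cases hij : i = j
      · subst hij; simp [thetaDistFun, thetaDist]; omega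
      · simp [thetaDistFun, thetaDist, hij]; omega
    · simp [thetaPathVertex, h0.ne', h3, thetaDistFun, show k' - 1 + 1 = k' by omega]

theorem thetaDist_succ {m : ℕ} {i j : Fin 3} {k k' : ℕ} (hk : k ≤ len i) (hk' : k' < len j) :
    thetaDist len m i k j (k' + 1) ≤ thetaDist len m i k j k' + 1 ∧
    thetaDist len m i k j k' ≤ thetaDist len m i k j (k' + 1) + 1 := by
  by_cases hij : i = j
  · subst hij; simp only [thetaDist, if_true]; omega
  · simp only [thetaDist, if_neg hij]; omega

end ThetaPath

/-! ### Distances and symmetries of theta graphs -/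

section ThetaGraph

variable {l p q : ℕ}

theorem thetaGraph_adj_succ {i : Fin 3} {k : ℕ}
    (hk : k < ![l, p, q] i) :
    (thetaGraph l p q).Adj (thetaPathVertex _ i k) (thetaPathVertex _ i (k + 1)) := by
  rw [thetaGraph, SimpleGraph.fromRel_adj]
  refine ⟨?_, Or.inl ⟨i, k, hk, rfl, rfl⟩⟩
  unfold thetaPathVertex
  split_ifs <;> simp <;> omega

theorem thetaGraph_adj_exists {u v : ThetaVertex ![l, p, q]} (h : (thetaGraph l p q).Adj u v) :
    ∃ i k, k < ![l, p, q] i ∧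
      ((u = thetaPathVertex _ i k ∧ v = thetaPathVertex _ i (k + 1)) ∨
        (v = thetaPathVertex _ i k ∧ u = thetaPathVertex _ i (k + 1))) := by
  rw [thetaGraph, SimpleGraph.fromRel_adj] at h
  rcases h.2 with ⟨i, k, hk, hu, hv⟩ | ⟨i, k, hk, hu, hv⟩
  exacts [⟨i, k, hk, Or.inl ⟨hu, hv⟩⟩, ⟨i, k, hk, Or.inr ⟨hu, hv⟩⟩]

theorem thetaGraph_reachable_le {i : Fin 3} {k n : ℕ} (h : k + n ≤ ![l, p, q] i) :
    (thetaGraph l p q).Reachable (thetaPathVertex _ i k) (thetaPathVertex _ i (k + n)) := by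
  induction n with
  | zero => exact SimpleGraph.Reachable.refl _
  | succ n ih =>
    exact (ih (by omega)).trans (thetaGraph_adj_succ (show k + n < _ by omega)).reachable

theorem thetaGraph_connected (hlen : ∀ i, 0 < ![l, p, q] i) : (thetaGraph l p q).Connected := by
  have key : ∀ u, (thetaGraph l p q).Reachable (thetaPathVertex _ 0 0) u := by
    intro u
    obtain ⟨i, k, hk, rfl⟩ := exists_eq_thetaPathVertex hlen u
    have := thetaGraph_reachable_le (i := i) (k := 0) (n := k) (l := l) (p := p) (q := q) (by omega)
    rwa [thetaPathVertex_zero, zero_add, ← thetaPathVertex_zero 0] at this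
  have : Nonempty (ThetaVertex ![l, p, q]) := ⟨Sum.inl 0⟩
  exact SimpleGraph.Connected.mk fun u v => (key u).symm.trans (key v)

theorem thetaGraph_dist_le_sub (hlen : ∀ i, 0 < ![l, p, q] i) {i : Fin 3} {k k' : ℕ}
    (hk : k ≤ k') (h : k' ≤ ![l, p, q] i) :
    (thetaGraph l p q).dist (thetaPathVertex _ i k) (thetaPathVertex _ i k') ≤ k' - k := by
  obtain ⟨n, rfl⟩ := Nat.exists_eq_add_of_le hk
  clear hk
  induction n with
  | zero => simp
  | succ n ih =>
    have h1 := (thetaGraph_connected hlen).dist_triangle (u := thetaPathVertex _ i k)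
      (v := thetaPathVertex _ i (k + n)) (w := thetaPathVertex _ i (k + n + 1))
    rw [SimpleGraph.dist_eq_one_iff_adj.2
      (thetaGraph_adj_succ (show k + n < ![l, p, q] i by omega))] at h1
    have := ih (by omega)
    rw [← add_assoc]
    omega

/-- The upper bound comes from triangle inequalities through the branch vertices, the lower bound
from `thetaDist` being 1-Lipschitz in its second vertex. -/
theorem thetaGraph_dist {m : ℕ} (hlen : ∀ i, 0 < ![l, p, q] i) (hm : ∀ i, m ≤ ![l, p, q] i)
    (hm' : ∃ i, ![l, p, q] i = m) {i j : Fin 3} {k k' : ℕ} (hk : k ≤ ![l, p, q] i)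
    (hk' : k' ≤ ![l, p, q] j) :
    (thetaGraph l p q).dist (thetaPathVertex _ i k) (thetaPathVertex _ j k') =
      thetaDist ![l, p, q] m i k j k' := by
  have hc := thetaGraph_connected hlen
  refine le_antisymm ?_ ?_
  · have zero : ∀ (i : Fin 3) (k : ℕ), k ≤ ![l, p, q] i →
        (thetaGraph l p q).dist (thetaPathVertex _ i k) (Sum.inl 0) ≤ k := by
      intro i k hk
      rw [SimpleGraph.dist_comm, ← thetaPathVertex_zero i]
      exact thetaGraph_dist_le_sub hlen (Nat.zero_le k) hk
    have one : ∀ (i : Fin 3) (k : ℕ), k ≤ ![l, p, q] i →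
        (thetaGraph l p q).dist (thetaPathVertex _ i k) (Sum.inl 1) ≤ ![l, p, q] i - k := by
      intro i k hk
      rw [← thetaPathVertex_len (hlen i)]
      exact thetaGraph_dist_le_sub hlen hk le_rfl
    have ends : (thetaGraph l p q).dist (Sum.inl 0) (Sum.inl 1) ≤ m := by
      obtain ⟨i, rfl⟩ := hm'
      have := one i 0 (Nat.zero_le _)
      rwa [thetaPathVertex_zero] at this
    have a1 := zero i k hk
    have a2 := zero j k' hk'
    have b1 := one i k hk
    have b2 := one j k' hk'
    rw [SimpleGraph.dist_comm] at a2 b2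
    have t0 := hc.dist_triangle (u := thetaPathVertex _ i k) (v := Sum.inl 0)
      (w := thetaPathVertex _ j k')
    have t1 := hc.dist_triangle (u := thetaPathVertex _ i k) (v := Sum.inl 1)
      (w := thetaPathVertex _ j k')
    have t01 := hc.dist_triangle (u := Sum.inl 0) (v := Sum.inl 1)
      (w := thetaPathVertex _ j k')
    have t10 := hc.dist_triangle (u := Sum.inl 1) (v := Sum.inl 0)
      (w := thetaPathVertex _ j k')
    rw [SimpleGraph.dist_comm (u := Sum.inl 1) (v := Sum.inl 0)] at t10
    by_cases hij : i = j
    · subst hij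
      have d : (thetaGraph l p q).dist (thetaPathVertex _ i k) (thetaPathVertex _ i k') ≤
          k - k' + (k' - k) := by
        rcases le_total k k' with h | h
        · exact (thetaGraph_dist_le_sub hlen h hk').trans (by omega)
        · rw [SimpleGraph.dist_comm]
          exact (thetaGraph_dist_le_sub hlen h hk).trans (by omega)
      simp only [thetaDist, if_true]
      omega
    · simp only [thetaDist, if_neg hij]
      omega
  · have := (hc (thetaPathVertex _ i k) (thetaPathVertex _ j k')).le_add_dist
      (thetaDistFun ![l, p, q] m i k) ?_
    · rw [thetaDistFun_apply hm hk hk, thetaDistFun_apply hm hk hk'] at this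
      simpa [thetaDist] using this
    · intro x y hxy
      obtain ⟨j, t, ht, ⟨rfl, rfl⟩ | ⟨rfl, rfl⟩⟩ := thetaGraph_adj_exists hxy
      · rw [thetaDistFun_apply hm hk ht.le, thetaDistFun_apply hm hk ht]
        exact (thetaDist_succ hk ht).1
      · rw [thetaDistFun_apply hm hk ht.le, thetaDistFun_apply hm hk ht]
        exact (thetaDist_succ hk ht).2

/-- The map of theta graph vertices induced by a permutation of the three paths. -/
def thetaVertexEquiv {len len' : Fin 3 → ℕ} (σ : Equiv.Perm (Fin 3))
    (h : ∀ i, len' (σ i) = len i) : ThetaVertex len ≃ ThetaVertex len' :=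
  Equiv.sumCongr (Equiv.refl _)
    (Equiv.sigmaCongr σ fun i => finCongr (by rw [h i]))

theorem thetaVertexEquiv_apply {len len' : Fin 3 → ℕ} (σ : Equiv.Perm (Fin 3))
    (h : ∀ i, len' (σ i) = len i) (i : Fin 3) (k : ℕ) :
    thetaVertexEquiv σ h (thetaPathVertex len i k) = thetaPathVertex len' (σ i) k := by
  by_cases h0 : k = 0
  · simp [thetaPathVertex, thetaVertexEquiv, h0]
  by_cases h1 : k < len i
  · simp [thetaPathVertex, thetaVertexEquiv, h0, h1, h i, Equiv.sigmaCongr]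
  · simp [thetaPathVertex, thetaVertexEquiv, h0, h1, h i]

theorem thetaGraph_adj_equiv {l' p' q' : ℕ} (σ : Equiv.Perm (Fin 3))
    (h : ∀ i, ![l', p', q'] (σ i) = ![l, p, q] i) {u v : ThetaVertex ![l, p, q]}
    (huv : (thetaGraph l p q).Adj u v) :
    (thetaGraph l' p' q').Adj (thetaVertexEquiv σ h u) (thetaVertexEquiv σ h v) := by
  obtain ⟨i, k, hk, ⟨rfl, rfl⟩ | ⟨rfl, rfl⟩⟩ := thetaGraph_adj_exists huv
  · rw [thetaVertexEquiv_apply, thetaVertexEquiv_apply]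
    exact thetaGraph_adj_succ (by rwa [h i])
  · rw [thetaVertexEquiv_apply, thetaVertexEquiv_apply]
    exact (thetaGraph_adj_succ (by rwa [h i])).symm

theorem thetaVertexEquiv_symm {len len' : Fin 3 → ℕ} (hlen : ∀ i, 0 < len' i)
    (σ : Equiv.Perm (Fin 3)) (h : ∀ i, len' (σ i) = len i) (v : ThetaVertex len') :
    (thetaVertexEquiv σ h).symm v =
      thetaVertexEquiv σ.symm (fun i => by rw [← h, Equiv.apply_symm_apply]) v := by
  rw [Equiv.symm_apply_eq]
  obtain ⟨i, k, -, rfl⟩ := exists_eq_thetaPathVertex hlen v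
  rw [thetaVertexEquiv_apply, thetaVertexEquiv_apply, Equiv.apply_symm_apply]

def thetaGraphIso {l' p' q' : ℕ} (hlen : ∀ i, 0 < ![l', p', q'] i) (σ : Equiv.Perm (Fin 3))
    (h : ∀ i, ![l', p', q'] (σ i) = ![l, p, q] i) : thetaGraph l p q ≃g thetaGraph l' p' q' where
  toEquiv := thetaVertexEquiv σ h
  map_rel_iff' := by
    intro u v
    refine ⟨fun huv => ?_, thetaGraph_adj_equiv σ h⟩
    have := thetaGraph_adj_equiv σ.symm (fun i => by rw [← h, Equiv.apply_symm_apply]) huv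
    rwa [← thetaVertexEquiv_symm hlen σ h, ← thetaVertexEquiv_symm hlen σ h,
      Equiv.symm_apply_apply, Equiv.symm_apply_apply] at this

/-- Attaching pendant edges at corresponding vertices of isomorphic graphs. -/
def SimpleGraph.Iso.withPendant {V W : Type*} {G : SimpleGraph V} {H : SimpleGraph W}
    (f : G ≃g H) (v : V) : G.withPendant v ≃g H.withPendant (f v) where
  toEquiv := Equiv.optionCongr f.toEquiv
  map_rel_iff' := by
    intro x y
    cases x <;> cases y
    · simp
    · rw [SimpleGraph.adj_comm, SimpleGraph.adj_comm (G := G.withPendant v)]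
      simp
    · simp
    · simpa using f.map_rel_iff

theorem IsThetaPrime.perm {V : Type*} {G : SimpleGraph V} {l' p' q' : ℕ}
    (hG : IsThetaPrime G l p q) (σ : Equiv.Perm (Fin 3))
    (h : ∀ i, ![l', p', q'] (σ i) = ![l, p, q] i) (h1 : 1 ≤ l' ∧ 1 ≤ p' ∧ 1 ≤ q')
    (h2 : ¬(l' = 1 ∧ p' = 1) ∧ ¬(l' = 1 ∧ q' = 1) ∧ ¬(p' = 1 ∧ q' = 1)) :
    IsThetaPrime G l' p' q' := by
  obtain ⟨-, -, v, ⟨f⟩⟩ := hG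
  have hlen : ∀ i, 0 < ![l', p', q'] i := by
    intro i
    fin_cases i
    exacts [h1.1, h1.2.1, h1.2.2]
  exact ⟨h1, h2, _, ⟨f.trans ((thetaGraphIso hlen σ h).withPendant v)⟩⟩

theorem IsThetaPrime.swap_left {V : Type*} {G : SimpleGraph V} (hG : IsThetaPrime G l p q) :
    IsThetaPrime G p l q := by
  refine hG.perm (Equiv.swap 0 1) ?_ (by have := hG.1; tauto) (by have := hG.2.1; tauto)
  intro i
  fin_cases i <;> rfl

theorem IsThetaPrime.swap_right {V : Type*} {G : SimpleGraph V} (hG : IsThetaPrime G l p q) :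
    IsThetaPrime G l q p := by
  refine hG.perm (Equiv.swap 1 2) ?_ (by have := hG.1; tauto) (by have := hG.2.1; tauto)
  intro i
  fin_cases i <;> rfl

theorem IsThetaPrime.pos {V : Type*} {G : SimpleGraph V} (hG : IsThetaPrime G l p q) (i : Fin 3) :
    0 < ![l, p, q] i := by
  fin_cases i
  exacts [hG.1.1, hG.1.2.1, hG.1.2.2]

end ThetaGraph

/-! ### Change of lattice basis and removal of the pendant vertex -/

open Matrix in
/-- A Gram determinant does not change when the standard basis of a free `ℤ`-module is replaced
by a spanning family of the same cardinality. -/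
theorem det_gram_eq_of_span {ι κ : Type*} [Fintype ι] [DecidableEq ι] [Fintype κ] [DecidableEq κ]
    (M : Matrix ι ι ℤ) (w : κ → ι → ℤ) (hcard : Fintype.card κ = Fintype.card ι)
    (hspan : ∀ i, Pi.single i 1 ∈ Submodule.span ℤ (Set.range w)) :
    (Matrix.of fun i j => M.toBilin' (w i) (w j)).det = M.det := by
  obtain ⟨e⟩ := Fintype.card_eq.1 hcard.symm
  choose c hc using fun i => (Submodule.mem_span_range_iff_exists_fun ℤ).1 (hspan i)
  set W : Matrix ι ι ℤ := Matrix.of fun i => w (e i)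
  -- The coefficients expressing the standard basis in the spanning family form an integral inverse,
  -- so the determinant is a unit.
  have hW : IsUnit W.det := by
    refine Matrix.isUnit_det_of_left_inverse (B := Matrix.of fun i j => c i (e j)) ?_
    ext i j
    rw [Matrix.mul_apply]
    simp only [Matrix.of_apply, W]
    have := congrFun (hc i) j
    simp only [Finset.sum_apply, Pi.smul_apply, smul_eq_mul] at this
    rw [Matrix.one_apply, e.sum_comp (fun k => c i k * w k j), this, Pi.single_apply]
    simp [eq_comm]
  have h1 : (Matrix.of fun i j => M.toBilin' (w i) (w j)).submatrix e e = W * M * Wᵀ := by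
    ext i j
    simp only [Matrix.submatrix_apply, Matrix.of_apply, Matrix.toBilin'_apply, Matrix.mul_apply,
      Matrix.transpose_apply, W, Finset.sum_mul]
    exact Finset.sum_comm
  have h2 : W.det * W.det = 1 := by
    rcases Int.isUnit_iff.1 hW with h | h <;> simp [h]
  rw [← Matrix.det_submatrix_equiv_self e, h1, Matrix.det_mul, Matrix.det_mul,
    Matrix.det_transpose]
  linear_combination M.det * h2

theorem toBilin'_comm_of_isSymm {ι : Type*} [Fintype ι] [DecidableEq ι] {M : Matrix ι ι ℤ}
    (hM : M.IsSymm) (x y : ι → ℤ) : M.toBilin' x y = M.toBilin' y x := by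
  rw [Matrix.toBilin'_apply, Matrix.toBilin'_apply, Finset.sum_comm]
  refine Finset.sum_congr rfl fun i _ => Finset.sum_congr rfl fun j _ => ?_
  rw [hM.apply i j]
  ring

/-- The matrix `[[d, 1], [1, t]]`, whose last row and column are indexed by `none`. -/
def borderedMatrix {V : Type*} (d : V → V → ℤ) (t : ℤ) : Matrix (Option V) (Option V) ℤ :=
  Matrix.of fun u v => u.elim (v.elim t fun _ => 1) fun u => v.elim 1 fun v => d u v

section Bordered

variable {V : Type*} (d : V → V → ℤ) (t : ℤ)

@[simp] theorem borderedMatrix_some_some (u v : V) :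
    borderedMatrix d t (some u) (some v) = d u v := rfl

@[simp] theorem borderedMatrix_some_none (u : V) : borderedMatrix d t (some u) none = 1 := rfl

@[simp] theorem borderedMatrix_none_some (u : V) : borderedMatrix d t none (some u) = 1 := rfl

@[simp] theorem borderedMatrix_none_none : borderedMatrix d t none none = t := rfl

end Bordered

theorem SimpleGraph.det_distanceMatrix_eq_intCast {V : Type*} [Fintype V] [DecidableEq V]
    (G : SimpleGraph V) :
    G.distanceMatrix.det = ((Matrix.of fun u v => (G.dist u v : ℤ)).det : ℤ) := by
  rw [Int.cast_det]
  congr 1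

/-- The pendant vertex is one step farther than `v` from every old vertex, so the difference of the
two basis vectors pairs to 1 with each of them, and to `-2` with itself. -/
theorem SimpleGraph.det_distanceMatrix_withPendant {V : Type*} [Fintype V] [DecidableEq V]
    {H : SimpleGraph V} (hH : H.Connected) (v : V) :
    (H.withPendant v).distanceMatrix.det =
      ((borderedMatrix (fun u w => (H.dist u w : ℤ)) (-2)).det : ℤ) := by
  rw [SimpleGraph.det_distanceMatrix_eq_intCast, Int.cast_inj]
  let e : Option V → Option V → ℤ := fun u => Pi.single u 1
  let w : Option V → Option V → ℤ := fun u => u.elim (e none - e (some v)) fun u => e (some u)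
  have hw : ∀ u, w u ∈ Submodule.span ℤ (Set.range w) := fun u =>
    Submodule.subset_span ⟨u, rfl⟩
  rw [← det_gram_eq_of_span _ w rfl]
  · congr 1
    have h1 : ∀ u, (H.withPendant v).dist none (some u) = H.dist u v + 1 := fun u => by
      rw [SimpleGraph.dist_comm, SimpleGraph.withPendant_dist_none hH]
    ext x y
    cases x <;> cases y <;>
      simp [w, e, Matrix.toBilin'_single, SimpleGraph.withPendant_dist_none hH, h1,
        SimpleGraph.withPendant_dist_some hH, SimpleGraph.dist_comm (G := H) (u := v)]
  · intro i
    cases i with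
    | some u => exact hw (some u)
    | none =>
      have := add_mem (hw none) (hw (some v))
      simpa [w, e] using this

/-! ### Schur complement of a block `-(I + J)` -/

section FiniteRank

open Matrix

variable {m J : Type*} [Fintype m] [DecidableEq m] [Fintype J] [DecidableEq J]

theorem det_one_add_ones :
    (1 + Matrix.of fun _ _ => 1 : Matrix J J ℚ).det = Fintype.card J + 1 := by
  have h : (Matrix.of fun _ _ => 1 : Matrix J J ℚ) =
      Matrix.of (fun (_ : J) (_ : Unit) => (1 : ℚ)) *
        Matrix.of (fun (_ : Unit) (_ : J) => (1 : ℚ)) := by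
    ext i j
    simp [Matrix.mul_apply]
  rw [h, Matrix.det_one_add_mul_comm]
  simp [Matrix.mul_apply, add_comm]

/-- For size `n`, the inverse of `I + J` is `I - J / (n + 1)`. The off-diagonal blocks meet only the
index `ρ`, so the Schur complement changes one entry; the 0/1 values replace `∑ g²` by `∑ g`. -/
theorem det_fromBlocks_neg_one_add_ones (P : Matrix m m ℚ) (ρ : m) (g : J → ℚ)
    (hg : ∀ j, g j = 0 ∨ g j = 1) :
    (fromBlocks P (Matrix.of fun i j => if i = ρ then g j else 0)
      (Matrix.of fun j i => if i = ρ then g j else 0)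
      (-(1 + Matrix.of fun _ _ => 1))).det =
    (-1) ^ Fintype.card J * (Fintype.card J + 1) *
      (P + Matrix.single ρ ρ (∑ j, g j - (∑ j, g j) ^ 2 / (Fintype.card J + 1))).det := by
  have hn : (Fintype.card J + 1 : ℚ) ≠ 0 := by positivity
  set R : Matrix J J ℚ := -(1 - Matrix.of fun _ _ => 1 / (Fintype.card J + 1 : ℚ)) with hR
  have hinv : (-(1 + Matrix.of fun _ _ => 1) : Matrix J J ℚ) * R = 1 := by
    ext i j
    simp only [hR, neg_mul_neg, add_mul, mul_sub, one_mul, mul_one]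
    simp only [Matrix.sub_apply, Matrix.add_apply, Matrix.mul_apply, Matrix.of_apply,
      Matrix.one_apply]
    simp
    field_simp
    ring
  let _ : Invertible (-(1 + Matrix.of fun _ _ => 1) : Matrix J J ℚ) :=
    ⟨R, mul_eq_one_comm.1 hinv, hinv⟩
  have hR' : ⅟(-(1 + Matrix.of fun _ _ => 1) : Matrix J J ℚ) = R := rfl
  rw [Matrix.det_fromBlocks₂₂, Matrix.det_neg, det_one_add_ones, hR']
  congr 2
  ext i j
  have h2 : ∀ j, g j * g j = g j := fun j => by rcases hg j with h | h <;> simp [h]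
  by_cases hi : i = ρ
  · by_cases hj : j = ρ
    · subst hi; subst hj
      simp only [hR, Matrix.mul_neg, Matrix.neg_mul, Matrix.mul_apply, mul_sub, Matrix.add_apply,
        Matrix.sub_apply, Matrix.neg_apply, Matrix.of_apply, if_true, Matrix.one_apply,
        Matrix.single_apply_same, Finset.sum_sub_distrib, mul_ite, mul_one, mul_zero,
        Finset.sum_ite_eq', Finset.mem_univ, sub_mul, h2, ← Finset.sum_mul, ← Finset.mul_sum]
      ring
    · have : ¬ (ρ = i ∧ ρ = j) := fun h => hj h.2.symm
      simp [Matrix.mul_apply, hj, this]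
  · have : ¬ (ρ = i ∧ ρ = j) := fun h => hi h.1.symm
    simp [Matrix.mul_apply, hi, this]

theorem det_eq_of_chain {ι : Type*} [Fintype ι] [DecidableEq ι] (M : Matrix ι ι ℤ)
    (hM : M.IsSymm) (hcard : Fintype.card (m ⊕ J) = Fintype.card ι) (w : m → ι → ℤ)
    (s : J → ι → ℤ) (ρ : m) (g : J → ℤ)
    (hspan : ∀ i, Pi.single i 1 ∈ Submodule.span ℤ (Set.range (Sum.elim w s)))
    (hs : ∀ i j, M.toBilin' (s i) (s j) = -(1 + if i = j then 1 else 0))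
    (hws : ∀ i j, M.toBilin' (w i) (s j) = if i = ρ then g j else 0)
    (hg : ∀ j, g j = 0 ∨ g j = 1) :
    (M.det : ℚ) = (-1) ^ Fintype.card J * (Fintype.card J + 1) *
      ((Matrix.of fun i j => (M.toBilin' (w i) (w j) : ℚ)) +
        Matrix.single ρ ρ (∑ j, (g j : ℚ) - (∑ j, (g j : ℚ)) ^ 2 / (Fintype.card J + 1))).det := by
  have hsymm := toBilin'_comm_of_isSymm hM
  rw [← det_fromBlocks_neg_one_add_ones _ ρ (fun j => (g j : ℚ))
    (fun j => by exact_mod_cast hg j), ← det_gram_eq_of_span M _ hcard hspan, Int.cast_det]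
  congr 1
  ext x y
  rcases x with i | i <;> rcases y with j | j
  · simp
  · simp [hws]
  · simp [hsymm (s i), hws]
  · simp [hs, Matrix.one_apply]
    split_ifs <;> norm_num

end FiniteRank

/-! ### Vanishing determinants -/

theorem thetaDist_same_of_central {len : Fin 3 → ℕ} {m : ℕ} {i : Fin 3} {k t : ℕ}
    (hk : k ≤ len i) (h1 : len i ≤ 2 * t + m) (h2 : 2 * t ≤ len i + m) :
    thetaDist len m i k i t = k - t + (t - k) := by
  simp only [thetaDist, if_true]
  omega

/-- A vertex within `m / 2` of the middle of its path gains nothing from a detour along a shortest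
path between the branch vertices. -/
theorem thetaDist_of_central {len : Fin 3 → ℕ} {m : ℕ} {i j : Fin 3} {k t : ℕ} (hij : i ≠ j)
    (ht : t ≤ len j) (h1 : len j ≤ 2 * t + m) (h2 : 2 * t ≤ len j + m) :
    thetaDist len m i k j t = min (k + t) (len i - k + (len j - t)) := by
  simp only [thetaDist, if_neg hij]
  omega

section ThetaBordered

variable {V : Type*} [Fintype V] [DecidableEq V] {G : SimpleGraph V} {l p q : ℕ}

/-- The distance matrix of a theta graph, bordered by ones, with corner entry `-2`. -/
noncomputable def thetaBordered (l p q : ℕ) :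
    Matrix (Option (ThetaVertex ![l, p, q])) (Option (ThetaVertex ![l, p, q])) ℤ :=
  borderedMatrix (fun u w => ((thetaGraph l p q).dist u w : ℤ)) (-2)

theorem IsThetaPrime.det_distanceMatrix (hG : IsThetaPrime G l p q) :
    G.distanceMatrix.det = ((thetaBordered l p q).det : ℤ) := by
  have hc := thetaGraph_connected hG.pos
  obtain ⟨-, -, v, ⟨f⟩⟩ := hG
  rw [SimpleGraph.det_distanceMatrix_iso f
    (f.connected_iff.2 (SimpleGraph.withPendant_connected hc)),
    SimpleGraph.det_distanceMatrix_withPendant hc, thetaBordered]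

theorem thetaBordered_isSymm : (thetaBordered l p q).IsSymm := by
  ext x y
  cases x <;> cases y <;> simp [thetaBordered, SimpleGraph.dist_comm]

theorem thetaBordered_apply {m : ℕ} (hlen : ∀ i, 0 < ![l, p, q] i) (hm : ∀ i, m ≤ ![l, p, q] i)
    (hm' : ∃ i, ![l, p, q] i = m) {i j : Fin 3} {k k' : ℕ} (hk : k ≤ ![l, p, q] i)
    (hk' : k' ≤ ![l, p, q] j) :
    thetaBordered l p q (some (thetaPathVertex _ i k)) (some (thetaPathVertex _ j k')) =
      (thetaDist ![l, p, q] m i k j k' : ℕ) := by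
  rw [thetaBordered, borderedMatrix_some_some, thetaGraph_dist hlen hm hm' hk hk']

theorem IsThetaPrime.det_eq_zero_of_parallel_aux {g h s r : ℕ}
    (hG : IsThetaPrime G (2 * g + s) (2 * h + s) r) (hs : 1 ≤ s) (hsr : s ≤ r) (hg : g ≠ 0) :
    G.distanceMatrix.det = 0 := by
  rw [hG.det_distanceMatrix, Int.cast_eq_zero, ← Matrix.exists_mulVec_eq_zero_iff]
  have hlen := hG.pos
  set len : Fin 3 → ℕ := ![2 * g + s, 2 * h + s, r]
  obtain ⟨m, hm, hm'⟩ : ∃ m, (∀ i, m ≤ len i) ∧ ∃ i, len i = m := by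
    obtain ⟨i, -, hi⟩ := Finset.exists_min_image Finset.univ len Finset.univ_nonempty
    exact ⟨len i, fun j => hi j (Finset.mem_univ j), i, rfl⟩
  have hsm : s ≤ m := by
    obtain ⟨i, rfl⟩ := hm'
    fin_cases i <;> simp [len] <;> omega
  let e : Fin 3 → ℕ → Option (ThetaVertex len) → ℤ := fun i k =>
    Pi.single (some (thetaPathVertex len i k)) 1
  -- Vertices `g` and `h + s` are antipodal on the cycle of length `2 * (g + h + s)` formed by paths
  -- 0 and 1, as are `g + s` and `h`; all four are central because `s ≤ m`. From the third path both
  -- pairs also have equal distance sums.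
  refine ⟨e 0 g - e 0 (g + s) + e 1 (h + s) - e 1 h, ?_, ?_⟩
  · intro h0
    have h1 := congrFun h0 (some (thetaPathVertex len 0 g))
    have e0 : g < len 0 := by simp [len]; omega
    have e1 : g + s < len 0 := by simp [len]; omega
    -- As `g ≠ 0`, vertex `g` is interior to path 0, so its coefficient cannot cancel.
    have : ∀ k, thetaPathVertex len 0 g ≠ thetaPathVertex len 1 k := by
      intro k
      unfold thetaPathVertex
      split_ifs
      all_goals simp_all
    have h2 : thetaPathVertex len 0 g ≠ thetaPathVertex len 0 (g + s) := by
      unfold thetaPathVertex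
      rw [dif_neg hg, dif_pos e0, dif_neg (by omega), dif_pos e1]
      simp
      omega
    simp [e, this, h2] at h1
  · ext w
    simp only [e, Matrix.mulVec_add, Matrix.mulVec_sub, Matrix.mulVec_single_one,
      Pi.add_apply, Pi.sub_apply, Pi.zero_apply, Matrix.col_apply]
    cases w with
    | none => simp [thetaBordered]
    | some w =>
      obtain ⟨j, k, hk, rfl⟩ := exists_eq_thetaPathVertex hlen w
      have e0 : len 0 = 2 * g + s := rfl
      have e1 : len 1 = 2 * h + s := rfl
      have e2 : len 2 = r := rfl
      have m0 := hm 0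
      have m1 := hm 1
      have m2 := hm 2
      have key : ∀ (i : Fin 3) (t : ℕ), t ≤ len i → thetaBordered (2 * g + s) (2 * h + s) r
          (some (thetaPathVertex len j k)) (some (thetaPathVertex len i t)) =
            (thetaDist len m j k i t : ℕ) :=
        fun i t ht => thetaBordered_apply hlen hm hm' hk ht
      rw [key 0 g (by omega), key 0 (g + s) (by omega), key 1 h (by omega),
        key 1 (h + s) (by omega)]
      clear key hm hm' hlen
      by_cases h0 : j = 0
      · subst h0
        rw [thetaDist_same_of_central hk (by omega) (by omega),
          thetaDist_same_of_central hk (by omega) (by omega),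
          thetaDist_of_central (by decide) (by omega) (by omega) (by omega),
          thetaDist_of_central (by decide) (by omega) (by omega) (by omega)]
        omega
      by_cases h1 : j = 1
      · subst h1
        rw [thetaDist_same_of_central hk (by omega) (by omega),
          thetaDist_same_of_central hk (by omega) (by omega),
          thetaDist_of_central (by decide) (by omega) (by omega) (by omega),
          thetaDist_of_central (by decide) (by omega) (by omega) (by omega)]
        omega
      · rw [thetaDist_of_central h0 (by omega) (by omega) (by omega),
          thetaDist_of_central h0 (by omega) (by omega) (by omega),
          thetaDist_of_central h1 (by omega) (by omega) (by omega),
          thetaDist_of_central h1 (by omega) (by omega) (by omega)]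
        omega

theorem IsThetaPrime.det_eq_zero_of_parallel {g h s r : ℕ}
    (hG : IsThetaPrime G (2 * g + s) (2 * h + s) r) (hs : 1 ≤ s) (hsr : s ≤ r)
    (hgh : g ≠ 0 ∨ h ≠ 0) : G.distanceMatrix.det = 0 := by
  rcases hgh with hg | hh
  · exact hG.det_eq_zero_of_parallel_aux hs hsr hg
  · exact hG.swap_left.det_eq_zero_of_parallel_aux hs hsr hh

theorem IsThetaPrime.det_eq_zero_of_odd (hG : IsThetaPrime G l p q) (hl : Odd l) (hp : Odd p) :
    G.distanceMatrix.det = 0 := by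
  obtain ⟨g, rfl⟩ := hl
  obtain ⟨h, rfl⟩ := hp
  exact hG.det_eq_zero_of_parallel le_rfl hG.1.2.2 (by have := hG.2.1.1; omega)

/-- Two even paths need `s = 2`, hence a third path of length at least 2, whereas two odd ones allow
`s = 1`. For `l = p = 2` the two antipodal pairs coincide and the vector vanishes. -/
theorem IsThetaPrime.det_eq_zero_of_even (hG : IsThetaPrime G l p q) (hl : Even l) (hp : Even p)
    (hq : q ≠ 1) (hlp : l ≠ 2 ∨ p ≠ 2) : G.distanceMatrix.det = 0 := by
  have := hG.1
  obtain ⟨g, rfl⟩ : ∃ g, l = 2 * g + 2 := ⟨l / 2 - 1, by obtain ⟨g, rfl⟩ := hl; omega⟩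
  obtain ⟨h, rfl⟩ : ∃ h, p = 2 * h + 2 := ⟨p / 2 - 1, by obtain ⟨h, rfl⟩ := hp; omega⟩
  exact hG.det_eq_zero_of_parallel (by norm_num) (by omega) (by omega)

/-- The remaining theta graphs, after reordering the paths so that the first two are even. -/
theorem IsThetaPrime.det_eq_zero_of_even_even (hG : IsThetaPrime G l p q) (hl : Even l)
    (hp : Even p) (h1 : ¬ ∃ a b : ℕ, Even a ∧ Even b ∧ IsThetaPrime G 1 a b)
    (h2 : ¬ IsThetaPrime G 2 2 2) (h3 : ¬ ∃ c : ℕ, Odd c ∧ 1 < c ∧ IsThetaPrime G 2 2 c) :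
    G.distanceMatrix.det = 0 := by
  by_cases hq : q = 1
  · subst hq
    exact absurd ⟨l, p, hl, hp, hG.swap_right.swap_left⟩ h1
  by_cases hlp : l = 2 ∧ p = 2
  · obtain ⟨rfl, rfl⟩ := hlp
    rcases Nat.even_or_odd q with he | ho
    · exact hG.swap_right.det_eq_zero_of_even hl he (by norm_num)
        (Or.inr fun h => h2 (h ▸ hG))
    · have := hG.1
      exact absurd ⟨q, ho, by omega, hG⟩ h3
  · exact hG.det_eq_zero_of_even hl hp hq (by tauto)

/-- Two odd lengths already force zero; otherwise at least two lengths are even. -/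
theorem IsThetaPrime.det_eq_zero (hG : IsThetaPrime G l p q)
    (h1 : ¬ ∃ a b : ℕ, Even a ∧ Even b ∧ IsThetaPrime G 1 a b)
    (h2 : ¬ IsThetaPrime G 2 2 2) (h3 : ¬ ∃ c : ℕ, Odd c ∧ 1 < c ∧ IsThetaPrime G 2 2 c) :
    G.distanceMatrix.det = 0 := by
  rcases Nat.even_or_odd l with hl | hl <;> rcases Nat.even_or_odd p with hp | hp <;>
    rcases Nat.even_or_odd q with hq | hq
  · exact hG.det_eq_zero_of_even_even hl hp h1 h2 h3
  · exact hG.det_eq_zero_of_even_even hl hp h1 h2 h3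
  · exact hG.swap_right.det_eq_zero_of_even_even hl hq h1 h2 h3
  · exact hG.swap_left.swap_right.det_eq_zero_of_odd hp hq
  · exact hG.swap_left.swap_right.det_eq_zero_of_even_even hp hq h1 h2 h3
  · exact hG.swap_right.det_eq_zero_of_odd hl hq
  · exact hG.det_eq_zero_of_odd hl hp
  · exact hG.det_eq_zero_of_odd hl hp

end ThetaBordered

/-! ### The chain of an odd cycle -/

/-- The distance between vertices `i` and `j` of a cycle with vertices `0, …, n - 1`. -/
def cycleDist (n i j : ℕ) : ℕ := min (i - j + (j - i)) (n - (i - j + (j - i)))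

/-- A nearly antipodal pair cuts the cycle into arcs of lengths `g` and `g + 1`; the distance sum is
`g`, plus 1 strictly inside the longer arc. -/
theorem cycleDist_add_cycleDist {g i j : ℕ} (hi : i ≤ g) (hj : j ≤ 2 * g) :
    cycleDist (2 * g + 1) j i + cycleDist (2 * g + 1) j (i + g) =
      g + if j < i ∨ i + g < j then 1 else 0 := by
  unfold cycleDist
  split_ifs <;> omega

theorem cycleDist_add_cycleDist_succ {g i j : ℕ} (hi : i < g) (hj : j ≤ 2 * g) :
    cycleDist (2 * g + 1) j i + cycleDist (2 * g + 1) j (i + g + 1) =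
      g + if i < j ∧ j < i + g + 1 then 1 else 0 := by
  unfold cycleDist
  split_ifs <;> omega

/-- For the standard basis `E` of an odd cycle with vertices `0, …, 2 * g`, the combinations
`oddCycleChain E g x` with `x < 2 * g` generate, together with one vertex, the whole lattice, and
their Gram matrix with respect to the distance form is `-(I + J)`. -/
def oddCycleChain {X : Type*} [AddCommGroup X] (E : ℕ → X) (g x : ℕ) : X :=
  E g + E (2 * g) - E (g - x / 2 - 1) - E (2 * g - (x + 1) / 2)

theorem oddCycleChain_mem {X : Type*} [AddCommGroup X] {E : ℕ → X} {g : ℕ} {S : AddSubgroup X}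
    (hE : E 0 ∈ S) (hS : ∀ x < 2 * g, oddCycleChain E g x ∈ S) {i : ℕ} (hi : i ≤ 2 * g) :
    E i ∈ S := by
  -- As `x` grows, the subtracted pair moves one endpoint by one step, so consecutive chain vectors
  -- differ by an edge difference; `x = 0` supplies the edge below `g`.
  have step : ∀ i < 2 * g, E (i + 1) - E i ∈ S := by
    intro i hi
    rcases lt_or_ge i g with h | h
    · rcases Nat.eq_zero_or_pos (g - i - 1) with h0 | h0
      · have := hS 0 (by omega)
        rw [oddCycleChain, show g - 0 / 2 - 1 = i by omega, show 2 * g - (0 + 1) / 2 = 2 * g by omega,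
          show g = i + 1 by omega] at this
        convert this using 1
        abel
      · have := S.sub_mem (hS (2 * (g - i - 1)) (by omega)) (hS (2 * (g - i - 2) + 1) (by omega))
        rw [oddCycleChain, oddCycleChain, show g - 2 * (g - i - 1) / 2 - 1 = i by omega,
          show g - (2 * (g - i - 2) + 1) / 2 - 1 = i + 1 by omega,
          show (2 * (g - i - 1) + 1) / 2 = (2 * (g - i - 2) + 1 + 1) / 2 by omega] at this
        convert this using 1
        abel
    · have := S.sub_mem (hS (2 * (2 * g - 1 - i) + 1) (by omega))
        (hS (2 * (2 * g - 1 - i)) (by omega))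
      rw [oddCycleChain, oddCycleChain,
        show (2 * (2 * g - 1 - i) + 1) / 2 = 2 * (2 * g - 1 - i) / 2 by omega,
        show 2 * g - (2 * (2 * g - 1 - i) + 1 + 1) / 2 = i by omega,
        show 2 * g - 2 * (2 * g - 1 - i) / 2 = i + 1 by omega] at this
      convert this using 1
      abel
  induction i with
  | zero => exact hE
  | succ i ih => simpa using S.add_mem (step i (by omega)) (ih (by omega))

/-- The value of the distance form of an odd cycle on vertex `j` and `oddCycleChain E g x`. -/
def oddCycleRow (g x j : ℕ) : ℤ :=
  (if j < g then 1 else 0) -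
    if x % 2 = 1 then (if j < g - x / 2 - 1 ∨ 2 * g - (x + 1) / 2 < j then 1 else 0)
    else if g - x / 2 - 1 < j ∧ j < 2 * g - (x + 1) / 2 then 1 else 0

section OddCycle

variable {X : Type*} [AddCommGroup X] {B : LinearMap.BilinForm ℤ X} {E : ℕ → X}
  {g : ℕ}

theorem oddCycleChain_row
    (hB : ∀ i j, i ≤ 2 * g → j ≤ 2 * g → B (E i) (E j) = cycleDist (2 * g + 1) i j)
    {x j : ℕ} (hx : x < 2 * g) (hj : j ≤ 2 * g) :
    B (E j) (oddCycleChain E g x) = oddCycleRow g x j := by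
  simp only [oddCycleChain, map_add, map_sub]
  rw [hB _ _ hj (by omega), hB _ _ hj (by omega), hB _ _ hj (by omega), hB _ _ hj (by omega)]
  have h1 := cycleDist_add_cycleDist (i := g) le_rfl hj
  rw [← two_mul] at h1
  unfold oddCycleRow
  by_cases hp : x % 2 = 1
  · have h2 := cycleDist_add_cycleDist (i := g - x / 2 - 1) (by omega) hj
    rw [show g - x / 2 - 1 + g = 2 * g - (x + 1) / 2 by omega] at h2
    rw [if_pos hp]
    split_ifs at h1 h2 ⊢ <;> omega
  · have h2 := cycleDist_add_cycleDist_succ (i := g - x / 2 - 1) (by omega) hj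
    rw [show g - x / 2 - 1 + g + 1 = 2 * g - (x + 1) / 2 by omega] at h2
    rw [if_neg hp]
    split_ifs at h1 h2 ⊢ <;> omega

theorem oddCycleRow_zero {x : ℕ} (hx : x < 2 * g) :
    oddCycleRow g x 0 = if x % 2 = 0 ∨ x = 2 * g - 1 then 1 else 0 := by
  unfold oddCycleRow
  split_ifs <;> omega

theorem oddCycleRow_mid {x : ℕ} (hx : x < 2 * g) :
    oddCycleRow g x g = (x % 2 : ℕ) - 1 := by
  unfold oddCycleRow
  split_ifs <;> omega

theorem oddCycleRow_last {x : ℕ} (hx : x < 2 * g) :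
    oddCycleRow g x (2 * g) = -(x % 2 : ℕ) := by
  unfold oddCycleRow
  split_ifs <;> omega

/-- Pairing with a chain vector is a difference of arc indicators, so the claim reduces to comparing
arcs at four vertices. -/
theorem oddCycleChain_gram
    (hB : ∀ i j, i ≤ 2 * g → j ≤ 2 * g → B (E i) (E j) = cycleDist (2 * g + 1) i j)
    {x y : ℕ} (hx : x < 2 * g) (hy : y < 2 * g) :
    B (oddCycleChain E g y) (oddCycleChain E g x) = -(1 + if y = x then 1 else 0) := by
  have h : oddCycleChain E g y =
    E g + E (2 * g) - E (g - y / 2 - 1) - E (2 * g - (y + 1) / 2) := rfl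
  rw [h]
  simp only [map_add, map_sub, LinearMap.add_apply, LinearMap.sub_apply]
  rw [oddCycleChain_row hB hx (by omega), oddCycleChain_row hB hx (by omega),
    oddCycleChain_row hB hx (by omega), oddCycleChain_row hB hx (by omega), oddCycleRow_mid hx,
    oddCycleRow_last hx]
  clear h hB
  unfold oddCycleRow
  split_ifs <;> omega

end OddCycle

theorem sum_even_indicator (g : ℕ) :
    ∑ x ∈ Finset.range (2 * g), (if x % 2 = 0 then (1 : ℤ) else 0) = g := by
  induction g with
  | zero => simp
  | succ g ih =>
    rw [show 2 * (g + 1) = 2 * g + 1 + 1 by ring, Finset.sum_range_succ, Finset.sum_range_succ, ih]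
    simp

theorem sum_odd_indicator (g : ℕ) :
    ∑ x ∈ Finset.range (2 * g + 1), (if x % 2 = 1 then (1 : ℤ) else 0) = g := by
  induction g with
  | zero => simp
  | succ g ih =>
    rw [show 2 * (g + 1) + 1 = 2 * g + 1 + 1 + 1 by ring, Finset.sum_range_succ,
      Finset.sum_range_succ, ih]
    simp

theorem sum_oddCycleRow_zero {g : ℕ} (hg : 0 < g) :
    ∑ x : Fin (2 * g), oddCycleRow g x 0 = g + 1 := by
  rw [Fin.sum_univ_eq_sum_range (fun x => oddCycleRow g x 0)]
  have h : ∀ x ∈ Finset.range (2 * g), oddCycleRow g x 0 =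
      (if x % 2 = 0 then 1 else 0) + if x = 2 * g - 1 then 1 else 0 := by
    intro x hx
    rw [oddCycleRow_zero (Finset.mem_range.1 hx)]
    split_ifs <;> omega
  rw [Finset.sum_congr rfl h, Finset.sum_add_distrib, sum_even_indicator, Finset.sum_ite_eq',
    if_pos (Finset.mem_range.2 (by omega))]

/-! ### The graphs `θ(2, 2, odd)` -/

/-- The cycle of `θ(2, 2, 2 g - 1)` formed by the first and the third path, starting at the
middle vertex of the first path. -/
def twoTwoCycle (g i : ℕ) : ThetaVertex ![2, 2, 2 * g - 1] :=
  if i = 0 then thetaPathVertex _ 0 1 else thetaPathVertex _ 2 (i - 1)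

section TwoTwo

variable {g : ℕ}

theorem twoTwo_thetaBordered_apply (hg : 2 ≤ g) {i j : Fin 3} {k k' : ℕ}
    (hk : k ≤ ![2, 2, 2 * g - 1] i) (hk' : k' ≤ ![2, 2, 2 * g - 1] j) :
    thetaBordered 2 2 (2 * g - 1) (some (thetaPathVertex _ i k)) (some (thetaPathVertex _ j k')) =
      (thetaDist ![2, 2, 2 * g - 1] 2 i k j k' : ℕ) := by
  refine thetaBordered_apply ?_ ?_ ⟨0, rfl⟩ hk hk'
  · intro i
    fin_cases i <;> simp
    omega
  · intro i
    fin_cases i <;> simp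
    omega

theorem twoTwoCycle_apply (hg : 2 ≤ g) {i j : ℕ} (hi : i ≤ 2 * g) (hj : j ≤ 2 * g) :
    thetaBordered 2 2 (2 * g - 1) (some (twoTwoCycle g i)) (some (twoTwoCycle g j)) =
      cycleDist (2 * g + 1) i j := by
  have e0 : ![2, 2, 2 * g - 1] 0 = 2 := rfl
  have e2 : ![2, 2, 2 * g - 1] 2 = 2 * g - 1 := rfl
  unfold twoTwoCycle
  split_ifs with h1 h2 h2 <;> rw [twoTwo_thetaBordered_apply hg (by omega) (by omega)]
  · simp [thetaDist, cycleDist, h1, h2]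
  · simp only [thetaDist, cycleDist, h1, e0, e2]
    rw [if_neg (by decide)]
    omega
  · simp only [thetaDist, cycleDist, h2, e0, e2]
    rw [if_neg (by decide)]
    omega
  · simp only [thetaDist, cycleDist, e2, if_true]
    omega

/-- The middle vertices of the two short paths are twins at mutual distance 2. -/
theorem twoTwoCycle_apply_twin (hg : 2 ≤ g) {j : ℕ} (hj : j ≤ 2 * g) :
    thetaBordered 2 2 (2 * g - 1) (some (thetaPathVertex _ 1 1)) (some (twoTwoCycle g j)) =
      cycleDist (2 * g + 1) 0 j + if j = 0 then 2 else 0 := by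
  have e0 : ![2, 2, 2 * g - 1] 0 = 2 := rfl
  have e1 : ![2, 2, 2 * g - 1] 1 = 2 := rfl
  have e2 : ![2, 2, 2 * g - 1] 2 = 2 * g - 1 := rfl
  unfold twoTwoCycle
  split_ifs with h2 <;> rw [twoTwo_thetaBordered_apply hg (by omega) (by omega)]
  · simp [thetaDist, cycleDist, h2]
  · simp only [thetaDist, cycleDist, e1, e2]
    rw [if_neg (by decide)]
    omega

theorem twoTwo_vertex_cases (hg : 2 ≤ g) (v : ThetaVertex ![2, 2, 2 * g - 1]) :
    v = thetaPathVertex _ 1 1 ∨ ∃ i ≤ 2 * g, v = twoTwoCycle g i := by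
  have hlen : ∀ i, 0 < ![2, 2, 2 * g - 1] i := by
    intro i
    fin_cases i <;> simp
    omega
  have e2 : ![2, 2, 2 * g - 1] 2 = 2 * g - 1 := rfl
  have last : thetaPathVertex ![2, 2, 2 * g - 1] 2 (2 * g - 1) = Sum.inl 1 :=
    thetaPathVertex_len (hlen 2)
  have cyc : ∀ k ≤ 2 * g - 1, thetaPathVertex ![2, 2, 2 * g - 1] 2 k = twoTwoCycle g (k + 1) :=
    fun k hk => by simp [twoTwoCycle]
  have short : ∀ i : Fin 3, ![2, 2, 2 * g - 1] i = 2 → ∀ k ≤ 2, k ≠ 1 →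
      ∃ j ≤ 2 * g, thetaPathVertex ![2, 2, 2 * g - 1] i k = twoTwoCycle g j := by
    intro i hi k hk hk1
    rcases (show k = 0 ∨ k = 2 by omega) with rfl | rfl
    · exact ⟨1, by omega, by rw [← cyc 0 (by omega), thetaPathVertex_zero, thetaPathVertex_zero]⟩
    · refine ⟨2 * g - 1 + 1, by omega, ?_⟩
      rw [← cyc _ le_rfl, last]
      have := thetaPathVertex_len (hlen i)
      rwa [hi] at this
  obtain ⟨i, k, hk, rfl⟩ := exists_eq_thetaPathVertex hlen v
  by_cases h0 : i = 0
  · subst h0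
    by_cases h1 : k = 1
    · subst h1
      exact Or.inr ⟨0, by omega, rfl⟩
    · exact Or.inr (short 0 rfl k hk h1)
  by_cases h1 : i = 1
  · subst h1
    by_cases h1 : k = 1
    · subst h1
      exact Or.inl rfl
    · exact Or.inr (short 1 rfl k hk h1)
  · obtain rfl : i = 2 := by omega
    rw [e2] at hk
    exact Or.inr ⟨k + 1, by omega, cyc k hk⟩

theorem det_thetaBordered_twoTwo (hg : 2 ≤ g) :
    ((thetaBordered 2 2 (2 * g - 1)).det : ℚ) =
      -2 * ((2 * g - 1 : ℚ) ^ 2 + 2 * (2 * g - 1 : ℚ) - 9) := by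
  set B := (thetaBordered 2 2 (2 * g - 1)).toBilin' with hB
  set b : Option (ThetaVertex ![2, 2, 2 * g - 1]) → Option (ThetaVertex ![2, 2, 2 * g - 1]) → ℤ :=
    fun v => Pi.single v 1 with hb
  set E : ℕ → Option (ThetaVertex ![2, 2, 2 * g - 1]) → ℤ := fun i => b (some (twoTwoCycle g i))
    with hE
  have hBb : ∀ u v, B (b u) (b v) = thetaBordered 2 2 (2 * g - 1) u v := fun u v =>
    Matrix.toBilin'_single _ _ _
  have hEE : ∀ i j, i ≤ 2 * g → j ≤ 2 * g → B (E i) (E j) = cycleDist (2 * g + 1) i j :=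
    fun i j hi hj => by rw [hBb, twoTwoCycle_apply hg hi hj]
  have htwin : ∀ j ≤ 2 * g, B (b (some (thetaPathVertex _ 1 1))) (E j) =
      cycleDist (2 * g + 1) 0 j + if j = 0 then 2 else 0 :=
    fun j hj => by rw [hBb, twoTwoCycle_apply_twin hg hj]
  have hnE : ∀ j, B (b none) (E j) = 1 := fun j => by rw [hBb]; rfl
  have hEn : ∀ j, B (E j) (b none) = 1 := fun j => by rw [hBb]; rfl
  have htn : B (b (some (thetaPathVertex _ 1 1))) (b none) = 1 := by rw [hBb]; rfl
  have hnt : B (b none) (b (some (thetaPathVertex _ 1 1))) = 1 := by rw [hBb]; rfl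
  have hnn : B (b none) (b none) = -2 := by rw [hBb]; rfl
  have htt : B (b (some (thetaPathVertex _ 1 1))) (b (some (thetaPathVertex _ 1 1))) = 0 := by
    rw [hBb, twoTwo_thetaBordered_apply hg (by simp) (by simp)]
    simp [thetaDist]
  have hsymm : ∀ u v, B u v = B v u := toBilin'_comm_of_isSymm thetaBordered_isSymm
  -- Twin minus `E 0` pairs with `E j` to `2` at `j = 0` and `0` elsewhere, while `2 * E 0 + E g + E
  -- (g + 1)` pairs to `2 * g + 1`, less 1 at `j = 0`. Doubling the latter and removing the constant
  -- with `b none` makes `z` orthogonal to the cycle; the twin keeps coefficient 1, so the basis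
  -- stays integral.
  obtain ⟨z, hz⟩ : ∃ z, z = b (some (thetaPathVertex _ 1 1)) - E 0 +
    (4 : ℤ) • E 0 + (2 : ℤ) • E g + (2 : ℤ) • E (g + 1) - (2 * (2 * g + 1) : ℤ) • b none := ⟨_, rfl⟩
  have hzE : ∀ j ≤ 2 * g, B z (E j) = 0 := by
    intro j hj
    rw [hz]
    simp only [map_add, map_sub, map_smul, LinearMap.add_apply, LinearMap.sub_apply,
      LinearMap.smul_apply, smul_eq_mul]
    rw [htwin j hj, hEE _ _ (by omega) hj, hEE _ _ (by omega) hj, hEE _ _ (by omega) hj, hnE]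
    unfold cycleDist
    split_ifs <;> omega
  have hEz : ∀ j ≤ 2 * g, B (E j) z = 0 := by
    intro j hj
    rw [hsymm, hzE j hj]
  have hzn : B z (b none) = 8 * g + 12 := by
    rw [hz]
    simp only [map_add, map_sub, map_smul, LinearMap.add_apply, LinearMap.sub_apply,
      LinearMap.smul_apply, smul_eq_mul, hEn, htn, hnn]
    ring
  have hnz : B (b none) z = 8 * g + 12 := by
    rw [hz]
    simp only [map_add, map_sub, map_smul, smul_eq_mul, hnE, hnt, hnn]
    ring
  have hzt : B z (b (some (thetaPathVertex _ 1 1))) = 4 := by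
    have h0 := htwin 0 (by omega)
    have h1 := htwin g (by omega)
    have h2 := htwin (g + 1) (by omega)
    rw [hsymm] at h0 h1 h2
    rw [hz]
    simp only [map_add, map_sub, map_smul, LinearMap.add_apply, LinearMap.sub_apply,
      LinearMap.smul_apply, smul_eq_mul, htt, hnt]
    rw [h0, h1, h2, if_pos rfl, if_neg (by omega), if_neg (by omega),
      show cycleDist (2 * g + 1) 0 0 = 0 by simp [cycleDist],
      show cycleDist (2 * g + 1) 0 g = g by unfold cycleDist; omega,
      show cycleDist (2 * g + 1) 0 (g + 1) = g by unfold cycleDist; omega]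
    push_cast
    ring
  have hzz : B z z = 4 - (2 * (2 * g + 1)) * (8 * g + 12) := by
    have : B z z = B z (b (some (thetaPathVertex _ 1 1)) - E 0 +
      (4 : ℤ) • E 0 + (2 : ℤ) • E g + (2 : ℤ) • E (g + 1) - (2 * (2 * g + 1) : ℤ) • b none) := by
      rw [← hz]
    rw [this]
    simp only [map_add, map_sub, map_smul, smul_eq_mul]
    rw [hzE _ (by omega), hzE _ (by omega), hzE _ (by omega), hzt, hzn]
    ring
  -- Chain vectors have coefficient sum zero, so they annihilate anything constant on the cycle.
  have hchain : ∀ (y : Option (ThetaVertex ![2, 2, 2 * g - 1]) → ℤ) (c : ℤ),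
      (∀ j ≤ 2 * g, B y (E j) = c) → ∀ x : Fin (2 * g), B y (oddCycleChain E g x) = 0 := by
    intro y c hy x
    simp only [oddCycleChain, map_add, map_sub]
    rw [hy _ (by omega), hy _ (by omega), hy _ (by omega), hy _ (by omega)]
    ring
  have main := det_eq_of_chain (thetaBordered 2 2 (2 * g - 1)) thetaBordered_isSymm
    (m := Fin 3) (J := Fin (2 * g)) ?_ ![E 0, b none, z] (fun x => oddCycleChain E g x) 0
    (fun x => oddCycleRow g x 0) ?_ ?_ ?_ ?_
  · have hsum : (∑ x : Fin (2 * g), (oddCycleRow g x 0 : ℚ)) = g + 1 := by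
      exact_mod_cast sum_oddCycleRow_zero (g := g) (by omega)
    rw [main, hsum, Matrix.det_fin_three]
    rw [← hB]
    have h00 : B (E 0) (E 0) = 0 := by rw [hEE _ _ (by omega) (by omega)]; simp [cycleDist]
    simp [hzz, hzn, hnz, hnn, h00, hnE, hEn, hEz, hzE]
    have : (2 * g + 1 : ℚ) ≠ 0 := by positivity
    field_simp
    ring
  · simp [Fin.sum_univ_three]
    omega
  · set S := Submodule.span ℤ (Set.range (Sum.elim ![E 0, b none, z]
      (fun x : Fin (2 * g) => oddCycleChain E g x))) with hS
    have hmem : ∀ i, Sum.elim ![E 0, b none, z]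
        (fun x : Fin (2 * g) => oddCycleChain E g x) i ∈ S := fun i =>
      Submodule.subset_span ⟨i, rfl⟩
    have hES : ∀ i ≤ 2 * g, E i ∈ S := fun i hi =>
      oddCycleChain_mem (S := S.toAddSubgroup) (hmem (Sum.inl 0))
        (fun x hx => hmem (Sum.inr ⟨x, hx⟩)) hi
    have hn : b none ∈ S := hmem (Sum.inl 1)
    have hzS : z ∈ S := hmem (Sum.inl 2)
    intro v
    rcases v with _ | v
    · exact hn
    rcases twoTwo_vertex_cases hg v with rfl | ⟨i, hi, rfl⟩
    · have : b (some (thetaPathVertex _ 1 1)) = z - (3 : ℤ) • E 0 - (2 : ℤ) • E g -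
          (2 : ℤ) • E (g + 1) + (2 * (2 * g + 1) : ℤ) • b none := by
        rw [hz]
        module
      change b (some (thetaPathVertex _ 1 1)) ∈ S
      rw [this]
      exact S.add_mem (S.sub_mem (S.sub_mem (S.sub_mem hzS (S.smul_mem _ (hES _ (by omega))))
        (S.smul_mem _ (hES _ (by omega)))) (S.smul_mem _ (hES _ (by omega)))) (S.smul_mem _ hn)
    · exact hES i hi
  · intro x y
    rw [← hB, oddCycleChain_gram hEE y.2 x.2]
    simp [Fin.ext_iff]
  · intro i x
    rw [← hB]
    fin_cases i
    · exact oddCycleChain_row hEE x.2 (by omega)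
    · exact hchain _ 1 (fun j _ => hnE j) x
    · exact hchain _ 0 hzE x
  · intro x
    rw [oddCycleRow_zero x.2]
    split_ifs <;> simp

end TwoTwo

/-! ### The graph `θ(2, 2, 2)` -/

theorem det_thetaBordered_two_two_two : (thetaBordered 2 2 2).det = 48 := by
  have hlen : ∀ i, 0 < ![2, 2, 2] i := by decide
  have happ : ∀ {i j : Fin 3} {k k' : ℕ}, k ≤ ![2, 2, 2] i → k' ≤ ![2, 2, 2] j →
      thetaBordered 2 2 2 (some (thetaPathVertex _ i k)) (some (thetaPathVertex _ j k')) =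
      (thetaDist ![2, 2, 2] 2 i k j k' : ℕ) := fun hk hk' =>
    thetaBordered_apply hlen (by decide) ⟨0, rfl⟩ hk hk'
  let b : Option (ThetaVertex ![2, 2, 2]) → Option (ThetaVertex ![2, 2, 2]) → ℤ :=
    fun v => Pi.single v 1
  let u : Fin 3 → ℕ → Option (ThetaVertex ![2, 2, 2]) := fun i k => some (thetaPathVertex _ i k)
  let w : Fin 6 → Option (ThetaVertex ![2, 2, 2]) :=
    ![none, u 0 0, u 0 2, u 0 1, u 1 1, u 2 1]
  rw [← det_gram_eq_of_span (thetaBordered 2 2 2) (fun i => b (w i)) (by simp [Fin.sum_univ_three])]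
  · have : (Matrix.of fun i j => (thetaBordered 2 2 2).toBilin' (b (w i)) (b (w j))) =
        !![-2, 1, 1, 1, 1, 1; 1, 0, 2, 1, 1, 1; 1, 2, 0, 1, 1, 1; 1, 1, 1, 0, 2, 2;
          1, 1, 1, 2, 0, 2; 1, 1, 1, 2, 2, 0] := by
      ext i j
      simp only [Matrix.of_apply, b, Matrix.toBilin'_single]
      fin_cases i <;> fin_cases j <;> first | rfl | exact happ (by decide) (by decide)
    rw [this]
    simp [Matrix.det_succ_row_zero, Fin.sum_univ_succ, Fin.succAbove]
  · have hmem : ∀ i, b (w i) ∈ Submodule.span ℤ (Set.range fun i => b (w i)) := fun i =>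
      Submodule.subset_span ⟨i, rfl⟩
    intro v
    rcases v with _ | (v | ⟨i, k⟩)
    · exact hmem 0
    · fin_cases v
      exacts [hmem 1, hmem 2]
    · fin_cases i <;> fin_cases k
      exacts [hmem 3, hmem 4, hmem 5]

/-! ### The graphs `θ(1, even, even)` -/

section ChordEven

variable {g h : ℕ}

theorem chord_thetaBordered_apply (hg : 0 < g) (hh : 0 < h) {i j : Fin 3} {k k' : ℕ}
    (hk : k ≤ ![1, 2 * g, 2 * h] i) (hk' : k' ≤ ![1, 2 * g, 2 * h] j) :
    thetaBordered 1 (2 * g) (2 * h) (some (thetaPathVertex _ i k))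
      (some (thetaPathVertex _ j k')) = (thetaDist ![1, 2 * g, 2 * h] 1 i k j k' : ℕ) := by
  refine thetaBordered_apply ?_ ?_ ⟨0, rfl⟩ hk hk'
  · intro i
    fin_cases i <;> simp <;> omega
  · intro i
    fin_cases i <;> simp <;> omega

theorem chord_apply_left (hg : 0 < g) (hh : 0 < h) {i j : ℕ} (hi : i ≤ 2 * g) (hj : j ≤ 2 * g) :
    thetaBordered 1 (2 * g) (2 * h) (some (thetaPathVertex _ 1 i))
      (some (thetaPathVertex _ 1 j)) = cycleDist (2 * g + 1) i j := by
  have e1 : ![1, 2 * g, 2 * h] 1 = 2 * g := rfl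
  rw [chord_thetaBordered_apply hg hh (by omega) (by omega)]
  simp only [thetaDist, cycleDist, e1, if_true]
  omega

theorem chord_apply_right (hg : 0 < g) (hh : 0 < h) {i j : ℕ} (hi : i ≤ 2 * h)
    (hj : j ≤ 2 * h) :
    thetaBordered 1 (2 * g) (2 * h) (some (thetaPathVertex _ 2 (2 * h - i)))
      (some (thetaPathVertex _ 2 (2 * h - j))) = cycleDist (2 * h + 1) i j := by
  have e2 : ![1, 2 * g, 2 * h] 2 = 2 * h := rfl
  rw [chord_thetaBordered_apply hg hh (by omega) (by omega)]
  simp only [thetaDist, cycleDist, e2, if_true]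
  omega

/-- The right cycle is traversed backwards. Its vertices before `h` reach the left cycle through `E
(2 * g)`, those after `h` through `E 0`, and `h` itself is equidistant from both. -/
theorem chord_apply_right_left (hg : 0 < g) (hh : 0 < h) {i j : ℕ} (hi : i ≤ 2 * g)
    (hj : j ≤ 2 * h) :
    thetaBordered 1 (2 * g) (2 * h) (some (thetaPathVertex _ 2 (2 * h - j)))
      (some (thetaPathVertex _ 1 i)) =
      if j < h then (cycleDist (2 * g + 1) (2 * g) i + j : ℕ)
      else if h < j then (cycleDist (2 * g + 1) 0 i + (2 * h - j) : ℕ)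
      else (h + min i (2 * g - i) : ℕ) := by
  have e1 : ![1, 2 * g, 2 * h] 1 = 2 * g := rfl
  have e2 : ![1, 2 * g, 2 * h] 2 = 2 * h := rfl
  rw [chord_thetaBordered_apply hg hh (by omega) (by omega)]
  simp only [thetaDist, cycleDist, e1, e2]
  rw [if_neg (by decide)]
  split_ifs <;> omega

theorem chord_vertex_cases (hg : 0 < g) (hh : 0 < h) (v : ThetaVertex ![1, 2 * g, 2 * h]) :
    (∃ i ≤ 2 * g, v = thetaPathVertex _ 1 i) ∨
      ∃ j ≤ 2 * h, v = thetaPathVertex _ 2 (2 * h - j) := by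
  have hlen : ∀ i, 0 < ![1, 2 * g, 2 * h] i := by
    intro i
    fin_cases i <;> simp <;> omega
  obtain ⟨i, k, hk, rfl⟩ := exists_eq_thetaPathVertex hlen v
  by_cases h0 : i = 0
  · subst h0
    left
    rcases (Nat.le_one_iff_eq_zero_or_eq_one.1 hk) with rfl | rfl
    · exact ⟨0, by omega, by rw [thetaPathVertex_zero, thetaPathVertex_zero]⟩
    · exact ⟨2 * g, le_rfl, (thetaPathVertex_len (hlen 0)).trans (thetaPathVertex_len (hlen 1)).symm⟩
  by_cases h1 : i = 1
  · subst h1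
    exact Or.inl ⟨k, hk, rfl⟩
  · obtain rfl : i = 2 := by omega
    have hk' : k ≤ 2 * h := hk
    exact Or.inr ⟨2 * h - k, by omega, by rw [Nat.sub_sub_self hk']⟩

theorem det_thetaBordered_chord (hg : 0 < g) (hh : 0 < h) :
    ((thetaBordered 1 (2 * g) (2 * h)).det : ℚ) =
      ((1 + 2 * g + 2 * h : ℚ) ^ 2 - 1) / 2 := by
  have hlen : ∀ i, 0 < ![1, 2 * g, 2 * h] i := by
    intro i
    fin_cases i <;> simp <;> omega
  set B := (thetaBordered 1 (2 * g) (2 * h)).toBilin' with hB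
  set b : Option (ThetaVertex ![1, 2 * g, 2 * h]) → Option (ThetaVertex ![1, 2 * g, 2 * h]) → ℤ :=
    fun v => Pi.single v 1 with hb
  set E : ℕ → Option (ThetaVertex ![1, 2 * g, 2 * h]) → ℤ :=
    fun i => b (some (thetaPathVertex _ 1 i)) with hE
  set F : ℕ → Option (ThetaVertex ![1, 2 * g, 2 * h]) → ℤ :=
    fun i => b (some (thetaPathVertex _ 2 (2 * h - i))) with hF
  have hBb : ∀ u v, B (b u) (b v) = thetaBordered 1 (2 * g) (2 * h) u v := fun u v =>
    Matrix.toBilin'_single _ _ _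
  have hsymm : ∀ u v, B u v = B v u := toBilin'_comm_of_isSymm thetaBordered_isSymm
  have hEE : ∀ i j, i ≤ 2 * g → j ≤ 2 * g → B (E i) (E j) = cycleDist (2 * g + 1) i j :=
    fun i j hi hj => by rw [hBb, chord_apply_left hg hh hi hj]
  have hFF : ∀ i j, i ≤ 2 * h → j ≤ 2 * h → B (F i) (F j) = cycleDist (2 * h + 1) i j :=
    fun i j hi hj => by rw [hBb, chord_apply_right hg hh hi hj]
  have hnE : ∀ j, B (b none) (E j) = 1 := fun j => by rw [hBb]; rfl
  have hnF : ∀ j, B (b none) (F j) = 1 := fun j => by rw [hBb]; rfl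
  have hnn : B (b none) (b none) = -2 := by rw [hBb]; rfl
  have hEF0 : F (2 * h) = E 0 := by
    simp only [hE, hF, Nat.sub_self, thetaPathVertex_zero]
  have hEF1 : F 0 = E (2 * g) := by
    simp only [hE, hF, Nat.sub_zero]
    congr 2
    exact (thetaPathVertex_len (hlen 2)).trans (thetaPathVertex_len (hlen 1)).symm
  -- The offset from `F j` to the shared edge cancels in the chain vector, leaving the row of the
  -- nearer endpoint of that edge.
  have hFE : ∀ j ≤ 2 * h, ∀ x < 2 * g, B (F j) (oddCycleChain E g x) =
      if j < h then -((x % 2 : ℕ) : ℤ) else if h < j then oddCycleRow g x 0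
      else 1 - (x % 2 : ℕ) := by
    intro j hj x hx
    have hent : ∀ i ≤ 2 * g, B (F j) (E i) = _ := fun i hi => by
      rw [hBb, chord_apply_right_left hg hh hi hj]
    rcases lt_trichotomy j h with hjh | rfl | hjh
    · rw [if_pos hjh, ← oddCycleRow_last hx, ← oddCycleChain_row hEE hx le_rfl]
      simp only [oddCycleChain, map_add, map_sub]
      rw [hent _ (by omega), hent _ (by omega), hent _ (by omega), hent _ (by omega),
        hEE _ _ (by omega) (by omega), hEE _ _ (by omega) (by omega),
        hEE _ _ (by omega) (by omega), hEE _ _ (by omega) (by omega)]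
      simp only [if_pos hjh]
      push_cast
      ring
    · simp only [oddCycleChain, map_add, map_sub]
      rw [hent _ (by omega), hent _ (by omega), hent _ (by omega), hent _ (by omega)]
      simp only [lt_irrefl, if_false]
      omega
    · rw [if_neg hjh.le.not_gt, if_pos hjh, ← oddCycleChain_row hEE hx (Nat.zero_le _)]
      simp only [oddCycleChain, map_add, map_sub]
      rw [hent _ (by omega), hent _ (by omega), hent _ (by omega), hent _ (by omega),
        hEE _ _ (by omega) (by omega), hEE _ _ (by omega) (by omega),
        hEE _ _ (by omega) (by omega), hEE _ _ (by omega) (by omega)]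
      simp only [if_pos hjh, if_neg hjh.le.not_gt]
      push_cast
      ring
  -- The sign on the right chain makes cross pairings `-1`, so the two chains together again have
  -- Gram matrix `-(I + J)`. The bound on `y` keeps the last subtracted vertex beyond `h`.
  have hcross : ∀ y < 2 * h - 1, ∀ x < 2 * g,
      B (-oddCycleChain F h y) (oddCycleChain E g x) = -1 := by
    intro y hy x hx
    have hdef : oddCycleChain F h y =
      F h + F (2 * h) - F (h - y / 2 - 1) - F (2 * h - (y + 1) / 2) := rfl
    rw [hdef]
    simp only [map_add, map_sub, map_neg, LinearMap.add_apply, LinearMap.sub_apply,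
      LinearMap.neg_apply]
    rw [hFE _ (by omega) x hx, hFE _ (by omega) x hx, hFE _ (by omega) x hx,
      hFE _ (by omega) x hx, if_neg (by omega), if_neg (by omega), if_neg (by omega),
      if_pos (by omega), if_pos (by omega), if_neg (by omega), if_pos (by omega)]
    ring
  have main := det_eq_of_chain (thetaBordered 1 (2 * g) (2 * h)) thetaBordered_isSymm
    (m := Fin 2) (J := Fin (2 * g) ⊕ Fin (2 * h - 1)) ?_ ![E 0, b none]
    (Sum.elim (fun x => oddCycleChain E g x) (fun y => -oddCycleChain F h y)) 0
    (Sum.elim (fun x => oddCycleRow g x 0) (fun y => if (y : ℕ) % 2 = 1 then 1 else 0))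
    ?_ ?_ ?_ ?_
  · have hsum : (∑ x : Fin (2 * g), (oddCycleRow g x 0 : ℚ)) = g + 1 := by
      exact_mod_cast sum_oddCycleRow_zero hg
    have hsum' : (∑ y : Fin (2 * h - 1), (((if (y : ℕ) % 2 = 1 then 1 else 0 : ℤ)) : ℚ)) =
        h - 1 := by
      obtain ⟨n, rfl⟩ : ∃ n, h = n + 1 := ⟨h - 1, by omega⟩
      rw [Fin.sum_univ_eq_sum_range
        (fun y => (((if y % 2 = 1 then 1 else 0 : ℤ)) : ℚ)),
        show 2 * (n + 1) - 1 = 2 * n + 1 by omega]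
      have := sum_odd_indicator n
      push_cast
      rw [add_sub_cancel_right]
      exact_mod_cast this
    have h00 : B (E 0) (E 0) = 0 := by rw [hEE _ _ (by omega) (by omega)]; simp [cycleDist]
    have hcard : Fintype.card (Fin (2 * g) ⊕ Fin (2 * h - 1)) = 2 * (g + h - 1) + 1 := by
      simp
      omega
    rw [main, Fintype.sum_sum_type, Matrix.det_fin_two, ← hB, hcard,
      Odd.neg_one_pow ⟨_, rfl⟩]
    simp only [Sum.elim_inl, Sum.elim_inr]
    rw [hsum, hsum']
    simp [h00, hnn, hnE, hsymm (E 0) (b none)]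
    have : ((g + h - 1 : ℕ) : ℚ) = g + h - 1 := by
      rw [Nat.cast_sub (by omega)]
      simp
    rw [this]
    have : (g + h : ℚ) ≠ 0 := by positivity
    rw [show (2 * (g + h - 1) + 1 + 1 : ℚ) = 2 * (g + h) by ring]
    field_simp
    ring
  · simp [Fin.sum_univ_three]
    omega
  · set S := Submodule.span ℤ (Set.range (Sum.elim ![E 0, b none]
      (Sum.elim (fun x : Fin (2 * g) => oddCycleChain E g x)
        (fun y : Fin (2 * h - 1) => -oddCycleChain F h y)))) with hS
    have hmem : ∀ i, Sum.elim ![E 0, b none] (Sum.elim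
        (fun x : Fin (2 * g) => oddCycleChain E g x)
        (fun y : Fin (2 * h - 1) => -oddCycleChain F h y)) i ∈ S := fun i =>
      Submodule.subset_span ⟨i, rfl⟩
    have hn : b none ∈ S := hmem (Sum.inl 1)
    have hES : ∀ i ≤ 2 * g, E i ∈ S := fun i hi =>
      oddCycleChain_mem (S := S.toAddSubgroup) (hmem (Sum.inl 0))
        (fun x hx => hmem (Sum.inr (Sum.inl ⟨x, hx⟩))) hi
    have hFS : ∀ i ≤ 2 * h, F i ∈ S := by
      refine fun i hi => oddCycleChain_mem (S := S.toAddSubgroup) ?_ (fun y hy => ?_) hi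
      · rw [hEF1]
        exact hES _ le_rfl
      · by_cases hy' : y < 2 * h - 1
        · have := S.neg_mem (hmem (Sum.inr (Sum.inr ⟨y, hy'⟩)))
          simpa using this
        -- The omitted last vector, `y = 2 * h - 1`, is `F (2 * h) - F 0 = E 0 - E (2 * g)`,
        -- supported on the shared edge and thus already spanned by the left cycle.
        · rw [oddCycleChain, show h - y / 2 - 1 = 0 by omega,
            show 2 * h - (y + 1) / 2 = h by omega, hEF0, hEF1]
          have := S.sub_mem (hES 0 (by omega)) (hES (2 * g) le_rfl)
          change _ ∈ S
          convert this using 1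
          abel
    intro v
    rcases v with _ | v
    · exact hn
    rcases chord_vertex_cases hg hh v with ⟨i, hi, rfl⟩ | ⟨i, hi, rfl⟩
    exacts [hES i hi, hFS i hi]
  · rintro (x | x) (y | y)
    · simp only [Sum.elim_inl, ← hB]
      rw [oddCycleChain_gram hEE y.2 x.2]
      simp [Fin.ext_iff]
    · simp only [Sum.elim_inl, Sum.elim_inr, ← hB]
      rw [hsymm, hcross y y.2 x x.2]
      simp
    · simp only [Sum.elim_inl, Sum.elim_inr, ← hB]
      rw [hcross x x.2 y y.2]
      simp
    · simp only [Sum.elim_inr, ← hB, map_neg, LinearMap.neg_apply, neg_neg]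
      rw [oddCycleChain_gram hFF (by omega) (by omega)]
      simp [Fin.ext_iff]
  · intro i x
    rw [← hB]
    have key : ∀ c : ℤ, c + c - c - c = 0 := fun c => by ring
    fin_cases i <;> rcases x with x | x
    · exact oddCycleChain_row hEE x.2 (by omega)
    · change B (E 0) (-oddCycleChain F h x) = if (x : ℕ) % 2 = 1 then 1 else 0
      rw [← hEF0, map_neg, oddCycleChain_row hFF (by omega) le_rfl, oddCycleRow_last (by omega)]
      split_ifs <;> omega
    · change B (b none) (oddCycleChain E g x) = 0
      simp only [oddCycleChain, map_add, map_sub, hnE, key]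
    · change B (b none) (-oddCycleChain F h x) = 0
      simp only [oddCycleChain, map_neg, map_add, map_sub, hnF, key, neg_zero]
  · rintro (x | x)
    · simp only [Sum.elim_inl]
      rw [oddCycleRow_zero x.2]
      split_ifs <;> simp
    · simp only [Sum.elim_inr]
      split_ifs <;> simp

end ChordEven

/-! ### Assembly of the four cases -/

theorem mainTheorem2 {V : Type*} [Fintype V] [DecidableEq V] (G : SimpleGraph V)
    (l p q : ℕ) (hG : IsThetaPrime G l p q) :
    (∀ a b : ℕ, Even a → Even b → IsThetaPrime G 1 a b →
      G.distanceMatrix.det = ((1 + (a : ℚ) + (b : ℚ)) ^ 2 - 1) / 2) ∧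
    (IsThetaPrime G 2 2 2 → G.distanceMatrix.det = 48) ∧
    (∀ c : ℕ, Odd c → 1 < c → IsThetaPrime G 2 2 c →
      G.distanceMatrix.det = -2 * ((c : ℚ) ^ 2 + 2 * (c : ℚ) - 9)) ∧
    ((¬ ∃ a b : ℕ, Even a ∧ Even b ∧ IsThetaPrime G 1 a b) →
      ¬ IsThetaPrime G 2 2 2 →
      (¬ ∃ c : ℕ, Odd c ∧ 1 < c ∧ IsThetaPrime G 2 2 c) →
      G.distanceMatrix.det = 0) := by
  refine ⟨?_, ?_, ?_, hG.det_eq_zero⟩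
  · intro a b ha hb h
    have hpos := h.1
    obtain ⟨g, rfl⟩ := even_iff_exists_two_mul.1 ha
    obtain ⟨k, rfl⟩ := even_iff_exists_two_mul.1 hb
    rw [h.det_distanceMatrix, det_thetaBordered_chord (by omega) (by omega)]
    push_cast
    rfl
  · intro h
    rw [h.det_distanceMatrix, det_thetaBordered_two_two_two]
    norm_num
  · intro c hc h1 h
    obtain ⟨g, hg, rfl⟩ : ∃ g, 2 ≤ g ∧ c = 2 * g - 1 := by
      obtain ⟨n, rfl⟩ := hc
      exact ⟨n + 1, by omega, by omega⟩
    rw [h.det_distanceMatrix, det_thetaBordered_twoTwo hg, Nat.cast_sub (by omega)]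
    push_cast
    rfl
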